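/- Let $q=p^{l}$ with $p$ an odd prime and $l\ge 2$, let $n=q+1$ and $a=n/2$. *Conventions.* A stabilizer matrix $S(D)=(X(D)\mid Z(D))\in\mathbb F_q[D]^{(n-k)\times 2n}$ is a full-rank matrix satisfying the symplectic orthogonality $X(D)Z(1/D)^{t}-Z(D)X(1/D)^{t}=0$. It is of CSS type if every row is of the form $(x(D)\mid 0)$ or $(0\mid z(D))$. It is basic if it has a polynomial right inverse, and reduced basic if moreover its overall constraint length $\sum_i\gamma_i$, $\gamma_i=\max_j\deg S_{ij}$, is smallest among all basic matrices generating the same $\mathbb F_q[D]$-module; the degree of the code is then $\gamma=\sum_i\gamma_i$ and its memory is $\max_i\gamma_i$. The stabilizer is the set of generalized Pauli operators, on a semi-infinite stream of frames of $n$ qudits of dimension $q$, that correspond (up to scalars) to the $\mathbb F_q[D]$-combinations of the rows of $S(D)$. An error (a Pauli operator with finitely many non-identity components) is undetectable if it commutes with the stabilizer and does not belong to it up to scalars. The free distance $(d_z)_f$ (respectively $(d_x)_f$) is the least weight of an undetectable phase-shift error, i.e. one with components $Z(b)$ (respectively of an undetectable qudit-flip error, i.e. one with components $X(a)$). An asymmetric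 quantum convolutional code (AQCC) with parameters $[(n,k,\mu;\gamma,(d_z)_f/(d_x)_f)]_q$ is the code given by a reduced basic CSS-type stabilizer matrix with $n-k$ rows, memory $\mu$, degree $\gamma$ and these free distances. *Statement.* (a) For all integers $i,t$ with $3\le i\le a-1$ and $1\le t\le i-2$ there is an AQCC with parameters $[(n,\,2i-2t-2,\,\mu^{*};\,6,\,(d_z)_f/(d_x)_f)]_q$ for some memory $\mu^{*}$, where $(d_z)_f\ge n-2i$ and $(d_x)_f\ge 2t+2$. (b) For all integers $i,t$ with $2\le i\le a-1$ and $1\le t\le i-1$ there is an AQCC with parameters $[(n,\,2i-2t,\,\mu^{*};\,4,\,(d_z)_f/(d_x)_f)]_q$ for some memory $\mu^{*}$, where $(d_z)_f\ge n-2i$ and $(d_x)_f\ge 2t+2$. In both cases the code can be chosen with $(d_x)_f\le(d_z)_f$ whenever $2t+2\le n-2i$. -/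

import Mathlib

open Polynomial

noncomputable section

namespace QuantumConv

variable {F : Type*} [Field F] {n r : ℕ}

/-! A semi-infinite stream of frames of `n` qudits has one qudit for every time `i : ℕ` and every
position `j : Fin n`. A finitely supported stream of elements of `F` is a vector of polynomials,
the coefficient of `D ^ i` in the `j`-th polynomial being the entry at time `i`, position `j`.
A vector indexed by `Fin n ⊕ Fin n` is a pair `(a(D) | b(D))` of such streams. -/

/-- The Euclidean inner product `∑ i, u_i · v_i` of two streams. -/
def streamInner (u v : Fin n → F[X]) : F :=
  ∑ j, ∑ i ∈ (u j).support, (u j).coeff i * (v j).coeff i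

/-- The error operator which is `X(a) Z(b)` at each qudit, `a` and `b` being the entries of
`e = (a(D) | b(D))` there. On the computational basis of the stream, indexed by finitely supported
streams `x`, it acts by `|x⟩ ↦ w ^ tr(b · x) |x + a⟩` with `w = exp (2 π i / p)`. -/
def pauliOp (p : ℕ) [NeZero p] [Algebra (ZMod p) F] (e : Fin n ⊕ Fin n → F[X]) :
    ((Fin n → F[X]) →₀ ℂ) →ₗ[ℂ] ((Fin n → F[X]) →₀ ℂ) :=
  Finsupp.linearCombination ℂ fun x =>
    Finsupp.single (x + e ∘ Sum.inl)
      (ZMod.stdAddChar (Algebra.trace (ZMod p) F (streamInner (e ∘ Sum.inr) x)))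

/-- The weight of an error: the number of qudits at which it is not the identity. -/
def weight (e : Fin n ⊕ Fin n → F[X]) : ℕ :=
  ∑ j, ((e (Sum.inl j)).support ∪ (e (Sum.inr j)).support).card

/-- Symplectic orthogonality `X(D) Z(1/D)ᵗ - Z(D) X(1/D)ᵗ = 0` of `S(D) = (X(D) | Z(D))`, an
identity of matrices of Laurent polynomials. -/
def SymplecticOrthogonal (S : Matrix (Fin r) (Fin n ⊕ Fin n) F[X]) : Prop :=
  S.toCols₁.map toLaurent * (S.toCols₂.map fun f => LaurentPolynomial.invert (toLaurent f)).transpose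
    - S.toCols₂.map toLaurent
      * (S.toCols₁.map fun f => LaurentPolynomial.invert (toLaurent f)).transpose = 0

/-- The stabilizer (modulo scalars): all combinations with coefficients in `F` of the rows of `S(D)`
and of their delays by `D, D ^ 2, …`, that is, the row space of the semi-infinite matrix. -/
def stabilizer (S : Matrix (Fin r) (Fin n ⊕ Fin n) F[X]) :
    Submodule F[X] (Fin n ⊕ Fin n → F[X]) :=
  Submodule.span F[X] (Set.range S.row)

/-- The constraint length `γ_i = max_j deg S_ij` of the `i`-th row. -/
def constraintLength {c : Type*} [Fintype c] (S : Matrix (Fin r) c F[X]) (i : Fin r) : ℕ :=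
  Finset.univ.sup fun j => (S i j).natDegree

/-- The overall constraint length `∑ i, γ_i`. -/
def overallConstraintLength {c : Type*} [Fintype c] (S : Matrix (Fin r) c F[X]) : ℕ :=
  ∑ i, constraintLength S i

/-- The memory `max_i γ_i`. -/
def memory {c : Type*} [Fintype c] (S : Matrix (Fin r) c F[X]) : ℕ :=
  Finset.univ.sup fun i => constraintLength S i

/-- A polynomial matrix is basic if it has a polynomial right inverse. -/
def IsBasic {c : Type*} [Fintype c] (S : Matrix (Fin r) c F[X]) : Prop :=
  ∃ R : Matrix c (Fin r) F[X], S * R = 1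

/-- A basic matrix is reduced if its overall constraint length is the smallest one among all basic
matrices that generate the same module. -/
def IsReducedBasic {c : Type*} [Fintype c] (S : Matrix (Fin r) c F[X]) : Prop :=
  IsBasic S ∧ ∀ T : Matrix (Fin r) c F[X], IsBasic T →
    Submodule.span F[X] (Set.range T.row) = Submodule.span F[X] (Set.range S.row) →
      overallConstraintLength S ≤ overallConstraintLength T

/-- CSS type: every row of the stabilizer matrix is of the form `(0 | Z)` or `(X | 0)`. -/
def IsCSS (S : Matrix (Fin r) (Fin n ⊕ Fin n) F[X]) : Prop :=
  ∀ i, (∀ j, S i (Sum.inl j) = 0) ∨ (∀ j, S i (Sum.inr j) = 0)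

/-- An error is undetectable if it commutes with the whole stabilizer without being in it. -/
def Undetectable (p : ℕ) [NeZero p] [Algebra (ZMod p) F]
    (S : Matrix (Fin r) (Fin n ⊕ Fin n) F[X]) (e : Fin n ⊕ Fin n → F[X]) : Prop :=
  (∀ s ∈ stabilizer S, Commute (pauliOp p e) (pauliOp p s)) ∧ e ∉ stabilizer S

/-- `d` is the free distance for phase-shift errors: all phase-shift errors of weight less than `d`
are detectable, and some one of weight `d` is not. -/
def IsPhaseFreeDist (p : ℕ) [NeZero p] [Algebra (ZMod p) F]
    (S : Matrix (Fin r) (Fin n ⊕ Fin n) F[X]) (d : ℕ) : Prop :=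
  IsLeast {w | ∃ b : Fin n → F[X],
    Undetectable p S (Sum.elim 0 b) ∧ weight (Sum.elim (0 : Fin n → F[X]) b) = w} d

/-- `d` is the free distance for qudit-flip errors. -/
def IsFlipFreeDist (p : ℕ) [NeZero p] [Algebra (ZMod p) F]
    (S : Matrix (Fin r) (Fin n ⊕ Fin n) F[X]) (d : ℕ) : Prop :=
  IsLeast {w | ∃ a : Fin n → F[X],
    Undetectable p S (Sum.elim a 0) ∧ weight (Sum.elim a (0 : Fin n → F[X])) = w} d

/-- `S` is a (reduced basic) stabilizer matrix of an asymmetric quantum convolutional code of CSS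
type with parameters `[(n, k, μ; γ, dz / dx)]_q`, where `q` is the order of `F` and `p` its
characteristic. -/
structure IsAQCC (p : ℕ) [NeZero p] [Algebra (ZMod p) F]
    (S : Matrix (Fin r) (Fin n ⊕ Fin n) F[X]) (k μ γ dz dx : ℕ) : Prop where
  orthogonal : SymplecticOrthogonal S
  full_rank : LinearIndependent F[X] S.row
  css : IsCSS S
  reduced_basic : IsReducedBasic S
  dimension : r + k = n
  memory_eq : memory S = μ
  degree_eq : overallConstraintLength S = γ
  phase_dist : IsPhaseFreeDist p S dz
  flip_dist : IsFlipFreeDist p S dx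

/-- There is an asymmetric quantum convolutional code over `F` with parameters
`[(n, k, μ; γ, dz / dx)]_q`. -/
def ExistsAQCC (p : ℕ) [NeZero p] (F : Type*) [Field F] [Algebra (ZMod p) F]
    (n k μ γ dz dx : ℕ) : Prop :=
  ∃ (r : ℕ) (S : Matrix (Fin r) (Fin n ⊕ Fin n) F[X]), IsAQCC p S k μ γ dz dx

end QuantumConv

end

/-!
The codes are of CSS type. Their qudit-flip generators are the rows of a polynomial matrix `A(D)`
and their phase-shift generators the rows of a constant matrix `Z`, with `A(D) Zᵗ = 0`.

*Distances.* The stabilizer acts on a semi-infinite stream, so a generator may be delayed up to the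
last frame that an error meets. There only the generator's frame at time zero counts, so the last
frame of an undetected error is a nonzero word of the dual of the block code generated by that
frame (`le_streamWeight`). The free distances are therefore at least the distances of the duals of
`A(0)` and of `Z`, and the higher coefficients of `A(D)` may be chosen freely as long as
orthogonality is kept.

*Block codes.* The words of length `q + 1` are the values of binary forms on the projective line.
The forms of degrees `d` and `q - 1 - d` are dual to each other, and a word orthogonal to all forms
of degree `d` has weight at least `d + 2` (`sum_projEval_mul_projEval`,
`card_support_of_forall_projEval`). Let `Z` be spanned by the forms of degree `2 t`, and `A(0)` by
the products `Q ^ (i - t) f` with `Q` an irreducible quadratic form and `f` of degree `q - 2 i - 1`.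
As `Q` has no zero on the line, `A(0)` is a rescaled code of forms of degree `q - 2 i - 1`, and it
lies in the dual of `Z`, which consists of the forms of degree `q - 2 t - 1`. The duals have
distances at least `q - 2 i + 1 = n - 2 i` and `2 t + 2`.

*Degree.* As `t < i`, the dual of `Z` contains a word `y` outside the code of `A(0)`, and
`A(D)` arises from `A(0)` by adding `D ^ γ y` to one row. Its leading row coefficients are
independent, so it is reduced of degree `γ` by the predictable-degree criterion
(`isReducedBasic_of_linearIndependent_leading`). This gives (b) with `γ = 4`, and (a) with `γ = 6`
and `t + 1` in place of `t`.

*Order of the distances.* The roles of `A(D)` and `Z` can be exchanged, which exchanges the two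
free distances.
-/

namespace QuantumConv

/-! ### Reduced basic polynomial matrices -/

theorem exists_mul_eq_one_of_linearIndependent_rows {F ι c : Type*} [Field F] [Fintype ι]
    [DecidableEq ι] [Fintype c] (L : Matrix ι c F) (hL : LinearIndependent F L.row) :
    ∃ R : Matrix c ι F, L * R = 1 := by
  classical
  have hinj : Function.Injective L.vecMulLinear := Matrix.vecMul_injective_iff.2 hL
  obtain ⟨g, hg⟩ := L.vecMulLinear.exists_leftInverse_of_injective (LinearMap.ker_eq_bot.2 hinj)
  refine ⟨Matrix.of fun j i => g (Pi.single j 1) i, ?_⟩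
  ext i k
  have h1 : g (L i) = Pi.single i 1 := by
    have := LinearMap.congr_fun hg (Pi.single i 1)
    simpa [Matrix.row] using this
  have h2 : g (L i) = ∑ j, L i j • g (Pi.single j 1) := by
    conv_lhs => rw [pi_eq_sum_univ' (L i)]
    rw [map_sum]
    refine Finset.sum_congr rfl fun j _ => ?_
    rw [map_smul]
  rw [Matrix.mul_apply, Matrix.one_apply]
  have h3 := congrFun (h1.symm.trans h2) k
  simp only [Finset.sum_apply, Pi.smul_apply, smul_eq_mul, Pi.single_apply] at h3
  simp only [Matrix.of_apply, ← h3, eq_comm]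

theorem natDegree_det_le_sum {R ι : Type*} [CommRing R] [Fintype ι] [DecidableEq ι]
    (M : Matrix ι ι R[X]) (d : ι → ℕ) (h : ∀ i j, (M i j).natDegree ≤ d i) :
    M.det.natDegree ≤ ∑ i, d i := by
  rw [← Matrix.det_transpose, Matrix.det_apply]
  refine natDegree_sum_le_of_forall_le _ _ fun σ _ => ?_
  refine (natDegree_smul_le _ _).trans ((natDegree_prod_le _ _).trans ?_)
  exact Finset.sum_le_sum fun i _ => h i _

theorem coeff_prod_sum_of_natDegree_le {R ι : Type*} [CommRing R] (s : Finset ι)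
    (f : ι → R[X]) (d : ι → ℕ) (h : ∀ i, (f i).natDegree ≤ d i) :
    (∏ i ∈ s, f i).coeff (∑ i ∈ s, d i) = ∏ i ∈ s, (f i).coeff (d i) := by
  classical
  induction s using Finset.induction_on with
  | empty => simp
  | insert a s ha ih =>
    rw [Finset.prod_insert ha, Finset.sum_insert ha, Finset.prod_insert ha, ← ih]
    exact coeff_mul_add_eq_of_natDegree_le (h a)
      ((natDegree_prod_le _ _).trans (Finset.sum_le_sum fun i _ => h i))

theorem coeff_det_sum {R ι : Type*} [CommRing R] [Fintype ι] [DecidableEq ι]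
    (M : Matrix ι ι R[X]) (d : ι → ℕ) (h : ∀ i j, (M i j).natDegree ≤ d i) :
    M.det.coeff (∑ i, d i) = (Matrix.of fun i j => (M i j).coeff (d i)).det := by
  rw [← Matrix.det_transpose, ← Matrix.det_transpose (Matrix.of _), Matrix.det_apply,
    Matrix.det_apply, finsetSum_coeff]
  refine Finset.sum_congr rfl fun σ _ => ?_
  rw [coeff_smul]
  congr 1
  exact coeff_prod_sum_of_natDegree_le _ _ _ fun i => h i _

theorem natDegree_le_constraintLength {F c : Type*} [Field F] [Fintype c] {r : ℕ}
    (S : Matrix (Fin r) c F[X]) (i : Fin r) (j : c) :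
    (S i j).natDegree ≤ constraintLength S i :=
  Finset.le_sup (f := fun j => (S i j).natDegree) (Finset.mem_univ j)

theorem natDegree_mul_map_C_le {F c : Type*} [Field F] [Fintype c] {r s : ℕ}
    (S : Matrix (Fin r) c F[X]) (R : Matrix c (Fin s) F) (i : Fin r) (k : Fin s) :
    ((S * R.map C) i k).natDegree ≤ constraintLength S i := by
  rw [Matrix.mul_apply]
  refine natDegree_sum_le_of_forall_le _ _ fun j _ => ?_
  rw [Matrix.map_apply]
  exact (natDegree_mul_C_le _ _).trans (natDegree_le_constraintLength S i j)

theorem exists_mul_eq_of_span_le {R c : Type*} [CommRing R] {r : ℕ}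
    (S T : Matrix (Fin r) c R)
    (h : Submodule.span R (Set.range T.row) ≤ Submodule.span R (Set.range S.row)) :
    ∃ U : Matrix (Fin r) (Fin r) R, U * S = T := by
  have h1 : ∀ i, ∃ u : Fin r → R, ∑ k, u k • S.row k = T.row i := fun i =>
    (Submodule.mem_span_range_iff_exists_fun R).1 (h (Submodule.subset_span ⟨i, rfl⟩))
  choose U hU using h1
  refine ⟨Matrix.of U, ?_⟩
  ext i j
  have := congrFun (hU i) j
  simpa [Matrix.mul_apply, Matrix.row] using this

theorem linearIndependent_rows_of_isBasic {F c : Type*} [Field F] [Fintype c] {r : ℕ}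
    {S : Matrix (Fin r) c F[X]} (hS : IsBasic S) : LinearIndependent F[X] S.row := by
  obtain ⟨R, hR⟩ := hS
  rw [← Matrix.vecMul_injective_iff]
  intro v w hvw
  have := congrArg (fun u => Matrix.vecMul u R) hvw
  simpa [Matrix.vecMul_vecMul, hR] using this

/-- The leading row coefficients of a polynomial matrix. -/
def leadingRows {F c : Type*} [Field F] [Fintype c] {r : ℕ} (S : Matrix (Fin r) c F[X]) :
    Matrix (Fin r) c F :=
  Matrix.of fun i j => (S i j).coeff (constraintLength S i)

/-- The predictable-degree criterion. Multiplying by a constant right inverse of the matrix of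
leading row coefficients turns `S` into a square matrix whose determinant has degree exactly the
overall constraint length of `S`; for another basic matrix of the same module this determinant
only changes by a unit, while its degree is at most the overall constraint length. -/
theorem isReducedBasic_of_linearIndependent_leading {F c : Type*} [Field F] [Fintype c] {r : ℕ}
    {S : Matrix (Fin r) c F[X]} (hS : IsBasic S)
    (hL : LinearIndependent F (leadingRows S).row) : IsReducedBasic S := by
  refine ⟨hS, fun T _ hspan => ?_⟩
  obtain ⟨U, hU⟩ := exists_mul_eq_of_span_le S T hspan.le
  obtain ⟨V, hV⟩ := exists_mul_eq_of_span_le T S hspan.ge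
  obtain ⟨Q, hQ⟩ := hS
  have hVU : V * U = 1 := by
    rw [← hU, ← Matrix.mul_assoc] at hV
    have := congrArg (· * Q) hV
    simpa [Matrix.mul_assoc, hQ] using this
  have hdetU : U.det ≠ 0 := by
    intro h0
    have := congrArg Matrix.det hVU
    simp [h0] at this
  obtain ⟨R, hR⟩ := exists_mul_eq_one_of_linearIndependent_rows _ hL
  have hcoeff : (S * R.map C).det.coeff (overallConstraintLength S) = 1 := by
    have h1 : (Matrix.of fun i k => ((S * R.map C) i k).coeff (constraintLength S i)) = 1 := by
      rw [← hR]
      ext i k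
      simp [leadingRows, Matrix.mul_apply, finsetSum_coeff]
    rw [overallConstraintLength, coeff_det_sum _ _ (natDegree_mul_map_C_le S R), h1,
      Matrix.det_one]
  have hdeg : overallConstraintLength S ≤ (S * R.map C).det.natDegree :=
    le_natDegree_of_ne_zero (by rw [hcoeff]; exact one_ne_zero)
  have hdet0 : (S * R.map C).det ≠ 0 := by
    intro h0
    simp [h0] at hcoeff
  calc overallConstraintLength S ≤ (S * R.map C).det.natDegree := hdeg
    _ ≤ (U.det * (S * R.map C).det).natDegree := by
      rw [natDegree_mul hdetU hdet0]
      exact Nat.le_add_left _ _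
    _ = (T * R.map C).det.natDegree := by rw [← Matrix.det_mul, ← Matrix.mul_assoc, hU]
    _ ≤ overallConstraintLength T := natDegree_det_le_sum _ _ (natDegree_mul_map_C_le T R)

/-! ### Stabilizer matrices of CSS type -/

/-- The stabilizer matrix of CSS type with the rows of `A` as qudit-flip generators `(A_i | 0)` and
the rows of `B` as phase-shift generators `(0 | B_j)`. -/
noncomputable def cssMatrix {F : Type*} [Field F] {n r s : ℕ} (A : Matrix (Fin r) (Fin n) F[X])
    (B : Matrix (Fin s) (Fin n) F[X]) : Matrix (Fin (r + s)) (Fin n ⊕ Fin n) F[X] :=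
  (Matrix.fromBlocks A 0 0 B).submatrix finSumFinEquiv.symm id

section

variable {F : Type*} [Field F] {n r s : ℕ} (A : Matrix (Fin r) (Fin n) F[X])
  (B : Matrix (Fin s) (Fin n) F[X])

@[simp]
theorem cssMatrix_castAdd (i : Fin r) : cssMatrix A B (Fin.castAdd s i) =
    Sum.elim (A i) (0 : Fin n → F[X]) := by
  ext1 j
  rcases j with j | j <;> simp [cssMatrix]

@[simp]
theorem cssMatrix_natAdd (j : Fin s) : cssMatrix A B (Fin.natAdd r j) =
    Sum.elim (0 : Fin n → F[X]) (B j) := by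
  ext1 i
  rcases i with i | i <;> simp [cssMatrix]

theorem isCSS_cssMatrix : IsCSS (cssMatrix A B) := by
  intro i
  refine Fin.addCases (fun i => ?_) (fun j => ?_) i
  · right; intro j; simp
  · left; intro j; simp

theorem constraintLength_cssMatrix_castAdd (i : Fin r) :
    constraintLength (cssMatrix A B) (Fin.castAdd s i) = constraintLength A i := by
  apply le_antisymm
  · refine Finset.sup_le fun j _ => ?_
    rcases j with j | j
    · simpa using natDegree_le_constraintLength A i j
    · simp
  · refine Finset.sup_le fun j _ => ?_
    simpa using natDegree_le_constraintLength (cssMatrix A B) (Fin.castAdd s i) (Sum.inl j)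

theorem constraintLength_cssMatrix_natAdd (i : Fin s) :
    constraintLength (cssMatrix A B) (Fin.natAdd r i) = constraintLength B i := by
  apply le_antisymm
  · refine Finset.sup_le fun j _ => ?_
    rcases j with j | j
    · simp
    · simpa using natDegree_le_constraintLength B i j
  · refine Finset.sup_le fun j _ => ?_
    simpa using natDegree_le_constraintLength (cssMatrix A B) (Fin.natAdd r i) (Sum.inr j)

theorem overallConstraintLength_cssMatrix :
    overallConstraintLength (cssMatrix A B)
      = overallConstraintLength A + overallConstraintLength B := by
  simp only [overallConstraintLength, Fin.sum_univ_add, constraintLength_cssMatrix_castAdd,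
    constraintLength_cssMatrix_natAdd]

variable {A B}

theorem isBasic_cssMatrix (hA : IsBasic A) (hB : IsBasic B) : IsBasic (cssMatrix A B) := by
  obtain ⟨P, hP⟩ := hA
  obtain ⟨Q, hQ⟩ := hB
  refine ⟨Matrix.of (Sum.elim (fun j => Fin.addCases (P j) 0) fun j => Fin.addCases 0 (Q j)), ?_⟩
  ext1 i k
  rw [Matrix.mul_apply, Fintype.sum_sum_type, Matrix.one_apply]
  refine Fin.addCases (fun i => ?_) (fun i => ?_) i <;>
    refine Fin.addCases (fun k => ?_) (fun k => ?_) k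
  · have := congrFun (congrFun hP i) k
    rw [Matrix.mul_apply, Matrix.one_apply] at this
    simp [this]
  · simp [Fin.ext_iff]; omega
  · simp [Fin.ext_iff]; omega
  · have := congrFun (congrFun hQ i) k
    rw [Matrix.mul_apply, Matrix.one_apply] at this
    simp [this]

theorem linearIndependent_leadingRows_cssMatrix (hA : LinearIndependent F (leadingRows A).row)
    (hB : LinearIndependent F (leadingRows B).row) :
    LinearIndependent F (leadingRows (cssMatrix A B)).row := by
  rw [Fintype.linearIndependent_iff] at *
  intro g hg
  rw [Fin.sum_univ_add] at hg
  have h1 := hA (fun i => g (Fin.castAdd s i)) (by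
    ext j
    simpa [leadingRows, Matrix.row, constraintLength_cssMatrix_castAdd] using
      congrFun hg (Sum.inl j))
  have h2 := hB (fun i => g (Fin.natAdd r i)) (by
    ext j
    simpa [leadingRows, Matrix.row, constraintLength_cssMatrix_natAdd] using
      congrFun hg (Sum.inr j))
  intro i
  refine Fin.addCases h1 h2 i

/-- The module generated by the rows of a polynomial matrix. -/
noncomputable def rowModule {F : Type*} [Field F] {n r : ℕ} (A : Matrix (Fin r) (Fin n) F[X]) :
    Submodule F[X] (Fin n → F[X]) :=
  Submodule.span F[X] (Set.range A.row)

theorem sumElim_mem_stabilizer_cssMatrix (a b : Fin n → F[X]) :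
    Sum.elim a b ∈ stabilizer (cssMatrix A B) ↔ a ∈ rowModule A ∧ b ∈ rowModule B := by
  rw [stabilizer, rowModule, rowModule, Submodule.mem_span_range_iff_exists_fun,
    Submodule.mem_span_range_iff_exists_fun, Submodule.mem_span_range_iff_exists_fun]
  simp only [Fin.sum_univ_add, Matrix.row, cssMatrix_castAdd, cssMatrix_natAdd]
  constructor
  · rintro ⟨c, hc⟩
    refine ⟨⟨fun i => c (Fin.castAdd s i), ?_⟩, ⟨fun i => c (Fin.natAdd r i), ?_⟩⟩
    · ext1 j; simpa using congrFun hc (Sum.inl j)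
    · ext1 j; simpa using congrFun hc (Sum.inr j)
  · rintro ⟨⟨c, rfl⟩, ⟨d, rfl⟩⟩
    refine ⟨Fin.addCases c d, ?_⟩
    ext1 j
    rcases j with j | j <;> simp

/-- Orthogonality `A(D) B(1/D)ᵗ = 0` of two polynomial matrices. -/
def LaurentOrthogonal (A : Matrix (Fin r) (Fin n) F[X]) (B : Matrix (Fin s) (Fin n) F[X]) : Prop :=
  ∀ i k, ∑ j, toLaurent (A i j) * LaurentPolynomial.invert (toLaurent (B k j)) = 0

theorem LaurentOrthogonal.symm (h : LaurentOrthogonal A B) : LaurentOrthogonal B A := by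
  intro k i
  have := congrArg LaurentPolynomial.invert (h i k)
  rw [map_sum, map_zero] at this
  rw [← this]
  refine Finset.sum_congr rfl fun j _ => ?_
  rw [map_mul, mul_comm]
  congr 1
  exact (LaurentPolynomial.invert.symm_apply_apply (toLaurent (B k j))).symm

theorem symplecticOrthogonal_cssMatrix (h : LaurentOrthogonal A B) :
    SymplecticOrthogonal (cssMatrix A B) := by
  have h' := h.symm
  ext1 i k
  simp only [Matrix.sub_apply, Matrix.mul_apply, Matrix.map_apply, Matrix.transpose_apply,
    Matrix.toCols₁_apply, Matrix.toCols₂_apply, Matrix.zero_apply]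
  refine Fin.addCases (fun i => ?_) (fun i => ?_) i <;>
    refine Fin.addCases (fun k => ?_) (fun k => ?_) k
  · simp
  · simpa using h i k
  · simpa using h' i k
  · simp

end

/-! ### Commutation with the stabilizer -/

theorem streamInner_eq_sum_range {F : Type*} [Field F] {n : ℕ} (u v : Fin n → F[X]) {N : ℕ}
    (hN : ∀ j, (u j).natDegree < N) :
    streamInner u v = ∑ j, ∑ i ∈ Finset.range N, (u j).coeff i * (v j).coeff i := by
  refine Finset.sum_congr rfl fun j _ => ?_
  refine Finset.sum_subset (fun i hi => ?_) fun i _ hi => ?_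
  · exact Finset.mem_range.2 ((le_natDegree_of_mem_supp i hi).trans_lt (hN j))
  · rw [notMem_support_iff.1 hi, zero_mul]

theorem streamInner_comm {F : Type*} [Field F] {n : ℕ} (u v : Fin n → F[X]) :
    streamInner u v = streamInner v u := by
  have h : ∀ w : Fin n → F[X], ∀ j, (w j).natDegree ≤ ∑ j, (w j).natDegree := fun w j =>
    Finset.single_le_sum (f := fun j => (w j).natDegree) (fun _ _ => Nat.zero_le _)
      (Finset.mem_univ j)
  rw [streamInner_eq_sum_range u v
      (N := ∑ j, (u j).natDegree + ∑ j, (v j).natDegree + 1) fun j => by have := h u j; omega,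
    streamInner_eq_sum_range v u
      (N := ∑ j, (u j).natDegree + ∑ j, (v j).natDegree + 1) fun j => by have := h v j; omega]
  simp only [mul_comm]

theorem streamInner_add_right {F : Type*} [Field F] {n : ℕ} (u v w : Fin n → F[X]) :
    streamInner u (v + w) = streamInner u v + streamInner u w := by
  simp [streamInner, mul_add, Finset.sum_add_distrib]

theorem streamInner_C_smul_right {F : Type*} [Field F] {n : ℕ} (c : F) (u v : Fin n → F[X]) :
    streamInner u ((C c : F[X]) • v) = c * streamInner u v := by
  simp only [streamInner, Pi.smul_apply, smul_eq_mul, coeff_C_mul, Finset.mul_sum]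
  simp only [mul_left_comm]

@[simp]
theorem streamInner_zero_left {F : Type*} [Field F] {n : ℕ} (v : Fin n → F[X]) :
    streamInner 0 v = 0 := by
  simp [streamInner]

@[simp]
theorem streamInner_zero_right {F : Type*} [Field F] {n : ℕ} (v : Fin n → F[X]) :
    streamInner v 0 = 0 := by
  simp [streamInner]

/-- Two errors `(a | b)` and `(a' | b')` commute iff `tr(b · a') = tr(b' · a)`. -/
theorem commute_pauliOp_iff {F : Type*} [Field F] {n : ℕ} (p : ℕ) [NeZero p] [Algebra (ZMod p) F]
    (e f : Fin n ⊕ Fin n → F[X]) :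
    Commute (pauliOp p e) (pauliOp p f) ↔
      Algebra.trace (ZMod p) F (streamInner (e ∘ Sum.inr) (f ∘ Sum.inl))
        = Algebra.trace (ZMod p) F (streamInner (f ∘ Sum.inr) (e ∘ Sum.inl)) := by
  have happ : ∀ (e : Fin n ⊕ Fin n → F[X]) x (z : ℂ), pauliOp p e (Finsupp.single x z) =
      Finsupp.single (x + e ∘ Sum.inl)
        (z * ZMod.stdAddChar (Algebra.trace (ZMod p) F (streamInner (e ∘ Sum.inr) x))) := by
    intro e x z
    simp [pauliOp, Finsupp.linearCombination_single]
  have hcomp : ∀ (e f : Fin n ⊕ Fin n → F[X]) x,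
      (pauliOp p e * pauliOp p f) (Finsupp.single x 1) =
      Finsupp.single (x + (e ∘ Sum.inl + f ∘ Sum.inl))
        (ZMod.stdAddChar (Algebra.trace (ZMod p) F (streamInner (f ∘ Sum.inr) x)
          + Algebra.trace (ZMod p) F (streamInner (e ∘ Sum.inr) x)
          + Algebra.trace (ZMod p) F (streamInner (e ∘ Sum.inr) (f ∘ Sum.inl)))) := by
    intro e f x
    rw [Module.End.mul_apply, happ, happ, streamInner_add_right, map_add, one_mul, add_assoc,
      add_comm (f ∘ Sum.inl)]
    simp only [AddChar.map_add_eq_mul, mul_assoc]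
  constructor
  · intro h
    have h1 := congrArg (fun g => g (Finsupp.single 0 1)) h.eq
    simp only [hcomp, streamInner_zero_right, map_zero, zero_add] at h1
    rw [add_comm (f ∘ Sum.inl)] at h1
    exact ZMod.injective_stdAddChar (Finsupp.single_injective _ h1)
  · intro h
    refine Finsupp.lhom_ext' fun x => LinearMap.ext_ring ?_
    simp only [LinearMap.comp_apply, Finsupp.lsingle_apply]
    rw [hcomp, hcomp, h, add_comm (e ∘ Sum.inl),
      add_comm (Algebra.trace (ZMod p) F (streamInner (f ∘ Sum.inr) x))]

/-- The trace form of a finite field is nondegenerate. -/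
theorem eq_zero_of_forall_trace_mul {F : Type*} [Field F] [Finite F] (p : ℕ) [Fact p.Prime]
    [Algebra (ZMod p) F] {x : F} (h : ∀ c : F, Algebra.trace (ZMod p) F (c * x) = 0) : x = 0 := by
  by_contra hx
  have : FiniteDimensional (ZMod p) F := Module.Finite.of_finite
  refine Algebra.trace_ne_zero (ZMod p) F (LinearMap.ext fun y => ?_)
  simpa [hx] using h (y * x⁻¹)

section

variable {F : Type*} [Field F] {n r s : ℕ}

/-- `b` is orthogonal to all combinations of the rows of `A` and of their delays. -/
def StreamOrthogonal (A : Matrix (Fin r) (Fin n) F[X]) (b : Fin n → F[X]) : Prop :=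
  ∀ v ∈ rowModule A, streamInner b v = 0

theorem streamOrthogonal_iff_trace [Finite F] (p : ℕ) [Fact p.Prime] [Algebra (ZMod p) F]
    {A : Matrix (Fin r) (Fin n) F[X]} {b : Fin n → F[X]} :
    StreamOrthogonal A b ↔
      ∀ v ∈ rowModule A, Algebra.trace (ZMod p) F (streamInner b v) = 0 := by
  refine ⟨fun h v hv => by rw [h v hv, map_zero], fun h v hv => ?_⟩
  refine eq_zero_of_forall_trace_mul p fun c => ?_
  rw [← streamInner_C_smul_right]
  exact h _ (Submodule.smul_mem _ _ hv)

/-- The number of nonzero coefficients of a stream. -/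
def streamWeight (b : Fin n → F[X]) : ℕ := ∑ j, (b j).support.card

variable (p : ℕ) [Fact p.Prime] [Algebra (ZMod p) F] [Finite F]
  (A : Matrix (Fin r) (Fin n) F[X]) (B : Matrix (Fin s) (Fin n) F[X])

theorem undetectable_phase_iff (b : Fin n → F[X]) :
    Undetectable p (cssMatrix A B) (Sum.elim 0 b) ↔ StreamOrthogonal A b ∧ b ∉ rowModule B := by
  rw [Undetectable, sumElim_mem_stabilizer_cssMatrix, streamOrthogonal_iff_trace p]
  simp only [Submodule.zero_mem, true_and, commute_pauliOp_iff, Sum.elim_comp_inl,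
    Sum.elim_comp_inr, streamInner_zero_right, map_zero]
  refine and_congr_left fun _ => ⟨fun h v hv => ?_, fun h e he => ?_⟩
  · simpa using h (Sum.elim v 0)
      ((sumElim_mem_stabilizer_cssMatrix _ _).2 ⟨hv, Submodule.zero_mem _⟩)
  · rw [← Sum.elim_comp_inl_inr e, sumElim_mem_stabilizer_cssMatrix] at he
    exact h _ he.1

theorem undetectable_flip_iff (a : Fin n → F[X]) :
    Undetectable p (cssMatrix A B) (Sum.elim a 0) ↔ StreamOrthogonal B a ∧ a ∉ rowModule A := by
  rw [Undetectable, sumElim_mem_stabilizer_cssMatrix, streamOrthogonal_iff_trace p]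
  simp only [Submodule.zero_mem, and_true, commute_pauliOp_iff, Sum.elim_comp_inl,
    Sum.elim_comp_inr, streamInner_zero_left, map_zero]
  refine and_congr_left fun _ => ⟨fun h v hv => ?_, fun h e he => ?_⟩
  · rw [streamInner_comm]
    simpa using (h (Sum.elim 0 v)
      ((sumElim_mem_stabilizer_cssMatrix _ _).2 ⟨Submodule.zero_mem _, hv⟩)).symm
  · rw [← Sum.elim_comp_inl_inr e, sumElim_mem_stabilizer_cssMatrix] at he
    rw [streamInner_comm]
    exact (h _ he.2).symm

/-- `d` is the least weight of a stream orthogonal to the rows of `A` and their delays but outside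
the module generated by the rows of `B`. -/
def IsRelativeDualDist (A : Matrix (Fin r) (Fin n) F[X]) (B : Matrix (Fin s) (Fin n) F[X])
    (d : ℕ) : Prop :=
  IsLeast {w | ∃ b : Fin n → F[X], (StreamOrthogonal A b ∧ b ∉ rowModule B) ∧ streamWeight b = w} d

theorem isPhaseFreeDist_cssMatrix_iff (d : ℕ) :
    IsPhaseFreeDist p (cssMatrix A B) d ↔ IsRelativeDualDist A B d := by
  simp [IsPhaseFreeDist, IsRelativeDualDist, undetectable_phase_iff, weight, streamWeight]

theorem isFlipFreeDist_cssMatrix_iff (d : ℕ) :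
    IsFlipFreeDist p (cssMatrix A B) d ↔ IsRelativeDualDist B A d := by
  simp [IsFlipFreeDist, IsRelativeDualDist, undetectable_flip_iff, weight, streamWeight]

/-- A pair of Laurent orthogonal polynomial matrices with independent leading rows yields an
asymmetric quantum convolutional code. -/
theorem existsAQCC_of_pair {A : Matrix (Fin r) (Fin n) F[X]} {B : Matrix (Fin s) (Fin n) F[X]}
    {k d₁ d₂ : ℕ} (hrk : r + s + k = n)
    (horth : LaurentOrthogonal A B) (hA : IsBasic A) (hB : IsBasic B)
    (hA' : LinearIndependent F (leadingRows A).row)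
    (hB' : LinearIndependent F (leadingRows B).row)
    (h₁ : IsRelativeDualDist A B d₁) (h₂ : IsRelativeDualDist B A d₂) :
    ∃ μ, ExistsAQCC p F n k μ (overallConstraintLength A + overallConstraintLength B) d₁ d₂ :=
  ⟨_, r + s, cssMatrix A B, {
    orthogonal := symplecticOrthogonal_cssMatrix horth
    full_rank := linearIndependent_rows_of_isBasic (isBasic_cssMatrix hA hB)
    css := isCSS_cssMatrix A B
    reduced_basic := isReducedBasic_of_linearIndependent_leading (isBasic_cssMatrix hA hB)
      (linearIndependent_leadingRows_cssMatrix hA' hB')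
    dimension := hrk
    memory_eq := rfl
    degree_eq := overallConstraintLength_cssMatrix A B
    phase_dist := (isPhaseFreeDist_cssMatrix_iff p A B d₁).2 h₁
    flip_dist := (isFlipFreeDist_cssMatrix_iff p A B d₂).2 h₂ }⟩

end

/-! ### Relative dual distances from the rows at time zero -/

section

variable {F : Type*} [Field F] {n r s : ℕ}

theorem coeff_zero_mem_span {A : Matrix (Fin r) (Fin n) F[X]} {v : Fin n → F[X]}
    (hv : v ∈ rowModule A) :
    (fun j => (v j).coeff 0) ∈ Submodule.span F (Set.range fun i j => (A i j).coeff 0) := by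
  rw [rowModule, Submodule.mem_span_range_iff_exists_fun] at hv
  obtain ⟨c, rfl⟩ := hv
  rw [Submodule.mem_span_range_iff_exists_fun]
  refine ⟨fun i => (c i).coeff 0, ?_⟩
  ext j
  simp [Matrix.row, mul_coeff_zero, finsetSum_coeff]

theorem streamInner_X_pow_smul (b v : Fin n → F[X]) {m : ℕ} (hm : ∀ j, (b j).natDegree ≤ m) :
    streamInner b ((X ^ m : F[X]) • v) = ∑ j, (b j).coeff m * (v j).coeff 0 := by
  rw [streamInner_eq_sum_range b _ fun j => Nat.lt_succ_of_le (hm j)]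
  refine Finset.sum_congr rfl fun j _ => ?_
  rw [Finset.sum_eq_single_of_mem m (Finset.self_mem_range_succ m)]
  · simp [coeff_X_pow_mul']
  · intro i hi him
    have : i < m := lt_of_le_of_ne (Nat.lt_succ_iff.1 (Finset.mem_range.1 hi)) him
    simp [coeff_X_pow_mul', this]

/-- The stabilizer starts at time zero, so delaying a generator of `A` up to the last frame met by
an error `b` leaves only the product of that frame with the generator's frame at time zero. Hence
the last frame of an undetected error is a nonzero word of the dual of `A(0)`. -/
theorem le_streamWeight [DecidableEq F] {A : Matrix (Fin r) (Fin n) F[X]} {d : ℕ}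
    (hA : ∀ b : Fin n → F, b ≠ 0 → (∀ i, ∑ j, b j * (A i j).coeff 0 = 0) →
      d ≤ (Finset.univ.filter fun j => b j ≠ 0).card)
    {b : Fin n → F[X]} (hb : b ≠ 0) (h : StreamOrthogonal A b) : d ≤ streamWeight b := by
  obtain ⟨j₀, hj₀⟩ := Function.ne_iff.1 hb
  obtain ⟨k, hk0, hk⟩ := Finset.exists_max_image (Finset.univ.filter fun j => b j ≠ 0)
    (fun j => (b j).natDegree) ⟨j₀, by simpa using hj₀⟩
  have hmax : ∀ j, (b j).natDegree ≤ (b k).natDegree := by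
    intro j
    by_cases hj : b j = 0
    · simp [hj]
    · exact hk j (by simpa using hj)
  refine (hA (fun j => (b j).coeff (b k).natDegree) ?_ fun i => ?_).trans ?_
  · refine Function.ne_iff.2 ⟨k, ?_⟩
    simpa using hk0
  · rw [← streamInner_X_pow_smul b (A i) hmax]
    exact h _ (Submodule.smul_mem _ _ (Submodule.subset_span ⟨i, rfl⟩))
  · rw [Finset.card_filter, streamWeight]
    refine Finset.sum_le_sum fun j _ => ?_
    split_ifs with hj
    · exact Finset.card_pos.2 ⟨_, mem_support_iff.2 hj⟩
    · exact Nat.zero_le _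

theorem streamOrthogonal_C {A : Matrix (Fin r) (Fin n) F[X]} {w : Fin n → F}
    (hw : ∀ i, ∑ j, w j * (A i j).coeff 0 = 0) : StreamOrthogonal A fun j => C (w j) := by
  intro v hv
  have h1 : streamInner (fun j => C (w j)) v = ∑ j, w j * (v j).coeff 0 := by
    simpa using streamInner_X_pow_smul (fun j => C (w j)) v (m := 0) fun j => by simp
  obtain ⟨c, hc⟩ := (Submodule.mem_span_range_iff_exists_fun F).1 (coeff_zero_mem_span hv)
  have h2 : ∀ j, (v j).coeff 0 = ∑ i, c i * (A i j).coeff 0 := fun j => by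
    simpa using (congrFun hc j).symm
  simp only [h1, h2, Finset.mul_sum]
  rw [Finset.sum_comm]
  refine Finset.sum_eq_zero fun i _ => ?_
  simp only [mul_left_comm _ (c i)]
  rw [← Finset.mul_sum, hw, mul_zero]

/-- The word `w`, placed at time zero, shows that some undetected error exists. -/
theorem exists_isRelativeDualDist [DecidableEq F] {A : Matrix (Fin r) (Fin n) F[X]}
    {B : Matrix (Fin s) (Fin n) F[X]} {d : ℕ}
    (hA : ∀ b : Fin n → F, b ≠ 0 → (∀ i, ∑ j, b j * (A i j).coeff 0 = 0) →
      d ≤ (Finset.univ.filter fun j => b j ≠ 0).card)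
    {w : Fin n → F} (hw : ∀ i, ∑ j, w j * (A i j).coeff 0 = 0)
    (hwB : w ∉ Submodule.span F (Set.range fun i j => (B i j).coeff 0)) :
    ∃ d', d ≤ d' ∧ IsRelativeDualDist A B d' := by
  classical
  have hne : ∃ w, ∃ b : Fin n → F[X],
      (StreamOrthogonal A b ∧ b ∉ rowModule B) ∧ streamWeight b = w :=
    ⟨_, _, ⟨streamOrthogonal_C hw, fun h => hwB (by simpa using coeff_zero_mem_span h)⟩, rfl⟩
  refine ⟨Nat.find hne, ?_, Nat.find_spec hne, fun k hk => Nat.find_min' hne hk⟩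
  obtain ⟨b, ⟨hb, hbB⟩, hbw⟩ := Nat.find_spec hne
  rw [← hbw]
  exact le_streamWeight hA (fun h => hbB (h ▸ Submodule.zero_mem _)) hb

end

/-! ### Codes with one delayed row -/

section

variable {F : Type*} [Field F] {n r s : ℕ}

/-- The polynomial matrix with rows `x_0 + D ^ g y, x_1, …, x_r`. -/
noncomputable def delayMatrix (x : Fin (r + 1) → Fin n → F) (y : Fin n → F) (g : ℕ) :
    Matrix (Fin (r + 1)) (Fin n) F[X] :=
  Matrix.of fun i j => C (x i j) + if i = 0 then X ^ g * C (y j) else 0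

theorem coeff_zero_delayMatrix (x : Fin (r + 1) → Fin n → F) (y : Fin n → F) {g : ℕ} (hg : 0 < g)
    (i : Fin (r + 1)) (j : Fin n) : (delayMatrix x y g i j).coeff 0 = x i j := by
  by_cases hi : i = 0 <;> simp [delayMatrix, hi, hg.ne]

theorem coeff_delayMatrix_zero (x : Fin (r + 1) → Fin n → F) (y : Fin n → F) {g : ℕ} (hg : 0 < g)
    (j : Fin n) : (delayMatrix x y g 0 j).coeff g = y j := by
  simp [delayMatrix, coeff_C, hg.ne']

theorem constraintLength_delayMatrix_zero (x : Fin (r + 1) → Fin n → F) {y : Fin n → F}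
    (hy : y ≠ 0) {g : ℕ} (hg : 0 < g) : constraintLength (delayMatrix x y g) 0 = g := by
  apply le_antisymm
  · refine Finset.sup_le fun j _ => ?_
    simp only [delayMatrix, Matrix.of_apply, if_true]
    refine (natDegree_add_le _ _).trans (max_le (by simp) ?_)
    exact (natDegree_mul_C_le _ _).trans (natDegree_X_pow_le g)
  · obtain ⟨j, hj⟩ := Function.ne_iff.1 hy
    refine le_trans ?_ (natDegree_le_constraintLength _ 0 j)
    exact le_natDegree_of_ne_zero (by rwa [coeff_delayMatrix_zero x y hg])

theorem constraintLength_delayMatrix_succ (x : Fin (r + 1) → Fin n → F) (y : Fin n → F) (g : ℕ)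
    (i : Fin r) : constraintLength (delayMatrix x y g) i.succ = 0 := by
  refine Nat.le_zero.1 (Finset.sup_le fun j _ => ?_)
  simp [delayMatrix]

theorem overallConstraintLength_delayMatrix (x : Fin (r + 1) → Fin n → F) {y : Fin n → F}
    (hy : y ≠ 0) {g : ℕ} (hg : 0 < g) : overallConstraintLength (delayMatrix x y g) = g := by
  simp [overallConstraintLength, Fin.sum_univ_succ, constraintLength_delayMatrix_zero x hy hg,
    constraintLength_delayMatrix_succ]

theorem linearIndependent_leadingRows_delayMatrix {x : Fin (r + 1) → Fin n → F} {y : Fin n → F}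
    (hxy : LinearIndependent F (Fin.cons y x : Fin (r + 2) → Fin n → F)) {g : ℕ} (hg : 0 < g) :
    LinearIndependent F (leadingRows (delayMatrix x y g)).row := by
  have hy : y ≠ 0 := hxy.ne_zero 0
  -- the leading rows are `y, x_1, …, x_r`
  have h : (leadingRows (delayMatrix x y g)).row =
      (Fin.cons y x : Fin (r + 2) → Fin n → F) ∘ Fin.succAbove 1 := by
    funext i j
    refine Fin.cases ?_ (fun i => ?_) i
    · simp [leadingRows, Matrix.row, constraintLength_delayMatrix_zero x hy hg,
        coeff_delayMatrix_zero x y hg]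
    · have : Fin.succAbove (1 : Fin (r + 2)) i.succ = i.succ.succ := by
        rw [← Fin.succ_zero_eq_one, Fin.succ_succAbove_succ, Fin.succAbove_zero]
      simp [leadingRows, Matrix.row, constraintLength_delayMatrix_succ,
        coeff_zero_delayMatrix x y hg, this]
  rw [h]
  exact hxy.comp _ Fin.succAbove_right_injective

theorem isBasic_delayMatrix {x : Fin (r + 1) → Fin n → F} {y : Fin n → F}
    (hxy : LinearIndependent F (Fin.cons y x : Fin (r + 2) → Fin n → F)) (g : ℕ) :
    IsBasic (delayMatrix x y g) := by
  obtain ⟨R, hR⟩ := exists_mul_eq_one_of_linearIndependent_rows (Matrix.of (Fin.cons y x)) hxy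
  have hR' : ∀ i k, ∑ j, (Fin.cons y x : Fin (r + 2) → Fin n → F) i j * R j k =
      if i = k then 1 else 0 := fun i k => by
    simpa [Matrix.mul_apply, Matrix.one_apply] using congrFun (congrFun hR i) k
  refine ⟨(R.submatrix id Fin.succ).map C, ?_⟩
  ext1 i k
  have h1 := congrArg C (hR' i.succ k.succ)
  have h2 := congrArg C (hR' 0 k.succ)
  simp only [Fin.cons_succ, Fin.cons_zero, map_sum, map_mul, Fin.succ_inj,
    (Fin.succ_ne_zero k).symm, if_false, map_zero] at h1 h2
  by_cases hi : i = 0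
  · simp only [delayMatrix, Matrix.mul_apply, Matrix.of_apply, Matrix.map_apply,
      Matrix.submatrix_apply, id, if_pos hi, add_mul, Finset.sum_add_distrib, h1, mul_assoc,
      ← Finset.mul_sum, h2, Matrix.one_apply]
    split_ifs <;> simp
  · simp only [delayMatrix, Matrix.mul_apply, Matrix.of_apply, Matrix.map_apply,
      Matrix.submatrix_apply, id, if_neg hi, add_zero, h1, Matrix.one_apply]
    split_ifs <;> simp

/-- The constant polynomial matrix with rows `z_0, z_1, …`. -/
noncomputable def constMatrix (z : Fin s → Fin n → F) : Matrix (Fin s) (Fin n) F[X] :=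
  Matrix.of fun i j => C (z i j)

theorem constraintLength_constMatrix (z : Fin s → Fin n → F) (i : Fin s) :
    constraintLength (constMatrix z) i = 0 := by
  refine Nat.le_zero.1 (Finset.sup_le fun j _ => ?_)
  simp [constMatrix]

theorem leadingRows_constMatrix (z : Fin s → Fin n → F) :
    (leadingRows (constMatrix z)).row = z := by
  funext i j
  rw [leadingRows, Matrix.row, Matrix.of_apply, constraintLength_constMatrix]
  simp [constMatrix]

theorem isBasic_constMatrix {z : Fin s → Fin n → F} (hz : LinearIndependent F z) :
    IsBasic (constMatrix z) := by
  obtain ⟨R, hR⟩ := exists_mul_eq_one_of_linearIndependent_rows (Matrix.of z) hz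
  refine ⟨R.map C, ?_⟩
  have : constMatrix z = (Matrix.of z).map C := rfl
  rw [this, ← Matrix.map_mul, hR, Matrix.map_one C C_0 C_1]

theorem laurentOrthogonal_delayMatrix_constMatrix {x : Fin (r + 1) → Fin n → F} {y : Fin n → F}
    {z : Fin s → Fin n → F} (hxz : ∀ i k, ∑ j, x i j * z k j = 0)
    (hyz : ∀ k, ∑ j, y j * z k j = 0) (g : ℕ) :
    LaurentOrthogonal (delayMatrix x y g) (constMatrix z) := by
  intro i k
  have h1 := congrArg (fun t => toLaurent (C t)) (hxz i k)
  have h2 := congrArg (fun t => toLaurent (C t)) (hyz k)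
  simp only [map_sum, map_mul, map_zero] at h1 h2
  by_cases hi : i = 0
  · simp only [delayMatrix, constMatrix, Matrix.of_apply, if_pos hi, map_add, map_mul, add_mul,
      toLaurent_C, LaurentPolynomial.invert_C, Finset.sum_add_distrib, mul_assoc,
      ← Finset.mul_sum] at h1 h2 ⊢
    rw [h1, h2, mul_zero, add_zero]
  · simpa only [delayMatrix, constMatrix, Matrix.of_apply, if_neg hi, add_zero,
      toLaurent_C, LaurentPolynomial.invert_C] using h1

/-- Two orthogonal constant matrices, the first of which can be enlarged by a row `y`, give codes
of every positive degree `g`: add `D ^ g y` to a row. Exchanging the two kinds of generators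
exchanges the two distances. -/
theorem exists_existsAQCC_of_delay [DecidableEq F] [Finite F] (p : ℕ) [Fact p.Prime]
    [Algebra (ZMod p) F] {x : Fin (r + 1) → Fin n → F} {y : Fin n → F} {z : Fin s → Fin n → F}
    {k g d₁ d₂ : ℕ} (hk : r + 1 + s + k = n) (hg : 0 < g)
    (hxy : LinearIndependent F (Fin.cons y x : Fin (r + 2) → Fin n → F))
    (hz : LinearIndependent F z)
    (hxz : ∀ i k, ∑ j, x i j * z k j = 0) (hyz : ∀ k, ∑ j, y j * z k j = 0)
    (hdx : ∀ b : Fin n → F, b ≠ 0 → (∀ i, ∑ j, b j * x i j = 0) →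
      d₁ ≤ (Finset.univ.filter fun j => b j ≠ 0).card)
    (hdz : ∀ b : Fin n → F, b ≠ 0 → (∀ i, ∑ j, b j * z i j = 0) →
      d₂ ≤ (Finset.univ.filter fun j => b j ≠ 0).card) :
    ∃ e₁ e₂, d₁ ≤ e₁ ∧ d₂ ≤ e₂ ∧ (∃ μ, ExistsAQCC p F n k μ g e₁ e₂) ∧
      ∃ μ, ExistsAQCC p F n k μ g e₂ e₁ := by
  have hcz : ∀ i j, (constMatrix z i j).coeff 0 = z i j := fun i j => by simp [constMatrix]
  have hy : y ≠ 0 := hxy.ne_zero 0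
  obtain ⟨R, hR⟩ := exists_mul_eq_one_of_linearIndependent_rows (Matrix.of (Fin.cons y x)) hxy
  have hR' : ∀ i, ∑ j, (Fin.cons y x : Fin (r + 2) → Fin n → F) i j * R j 0 =
      if i = 0 then 1 else 0 := fun i => by
    simpa [Matrix.mul_apply, Matrix.one_apply] using congrFun (congrFun hR i) 0
  -- a word orthogonal to the `x_i` but not to `y`, hence not a combination of the `z_k`
  obtain ⟨e₁, he₁, h₁⟩ : ∃ d', d₁ ≤ d' ∧
      IsRelativeDualDist (delayMatrix x y g) (constMatrix z) d' := by
    refine exists_isRelativeDualDist (w := fun j => R j 0) ?_ ?_ ?_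
    · simpa only [coeff_zero_delayMatrix x y hg] using hdx
    · intro i
      simp only [coeff_zero_delayMatrix x y hg]
      simpa [mul_comm] using hR' i.succ
    · simp only [hcz]
      rw [Submodule.mem_span_range_iff_exists_fun]
      rintro ⟨c, hc⟩
      have h0 := hR' 0
      have hc' : ∀ j, R j 0 = ∑ i, c i * z i j := fun j => by
        simpa using (congrFun hc j).symm
      simp only [Fin.cons_zero, hc', Finset.mul_sum, if_true] at h0
      rw [Finset.sum_comm, Finset.sum_eq_zero] at h0
      · exact zero_ne_one h0
      · intro i _
        simp only [mul_left_comm _ (c i)]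
        rw [← Finset.mul_sum, hyz, mul_zero]
  obtain ⟨e₂, he₂, h₂⟩ : ∃ d', d₂ ≤ d' ∧
      IsRelativeDualDist (constMatrix z) (delayMatrix x y g) d' := by
    refine exists_isRelativeDualDist (w := y) ?_ ?_ ?_
    · simpa only [hcz] using hdz
    · simpa only [hcz] using hyz
    · simp only [coeff_zero_delayMatrix x y hg]
      exact (linearIndependent_finCons.1 hxy).2
  have horth := laurentOrthogonal_delayMatrix_constMatrix hxz hyz g
  have hA := isBasic_delayMatrix hxy g
  have hB := isBasic_constMatrix hz
  have hA' := linearIndependent_leadingRows_delayMatrix hxy hg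
  have hB' : LinearIndependent F (leadingRows (constMatrix z)).row := by
    rwa [leadingRows_constMatrix]
  have hgA := overallConstraintLength_delayMatrix x hy hg
  have hgB : overallConstraintLength (constMatrix z) = 0 :=
    Finset.sum_eq_zero fun i _ => constraintLength_constMatrix z i
  refine ⟨e₁, e₂, he₁, he₂, ?_, ?_⟩
  · have := existsAQCC_of_pair p hk horth hA hB hA' hB' h₁ h₂
    rwa [hgA, hgB, add_zero] at this
  · have := existsAQCC_of_pair p (k := k) (by omega) horth.symm hB hA hB' hA' h₂ h₁
    rwa [hgA, hgB, zero_add] at this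

end

/-! ### Evaluation codes on the projective line -/

/-- The values of a polynomial of degree at most `d`, seen as a binary form of degree `d`, at the
points of the projective line: `none` is the point at infinity, where the value is the coefficient
of degree `d`. -/
def projEval {F : Type*} [Field F] (d : ℕ) (f : F[X]) : Option F → F :=
  fun o => o.elim (f.coeff d) fun α => f.eval α

theorem projEval_smul {F : Type*} [Field F] (d : ℕ) (c : F) (f : F[X]) :
    projEval d (c • f) = c • projEval d f := by
  funext o; cases o <;> simp [projEval]

theorem projEval_add {F : Type*} [Field F] (d : ℕ) (f g : F[X]) :
    projEval d (f + g) = projEval d f + projEval d g := by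
  funext o; cases o <;> simp [projEval]

theorem projEval_sum {F ι : Type*} [Field F] (d : ℕ) (s : Finset ι) (f : ι → F[X]) :
    projEval d (∑ i ∈ s, f i) = ∑ i ∈ s, projEval d (f i) := by
  classical
  induction s using Finset.induction_on with
  | empty => funext o; cases o <;> simp [projEval]
  | insert a s ha ih => rw [Finset.sum_insert ha, Finset.sum_insert ha, projEval_add, ih]

/-- The value of a product of two forms is the product of their values. -/
theorem projEval_mul {F : Type*} [Field F] {d e : ℕ} {f g : F[X]} (hf : f.natDegree ≤ d)
    (hg : g.natDegree ≤ e) (o : Option F) :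
    projEval (d + e) (f * g) o = projEval d f o * projEval e g o := by
  cases o with
  | none => exact coeff_mul_add_eq_of_natDegree_le hf hg
  | some α => simp [projEval]

theorem eq_zero_of_projEval_eq_zero {F : Type*} [Field F] [Fintype F] {d : ℕ} {f : F[X]}
    (hf : f.natDegree < Fintype.card F) (h : projEval d f = 0) : f = 0 := by
  classical
  refine eq_zero_of_natDegree_lt_card_of_eval_eq_zero' f Finset.univ (fun α _ => ?_) ?_
  · simpa [projEval] using congrFun h (some α)
  · simpa using hf

theorem sum_pow_card_sub_one {F : Type*} [Field F] [Fintype F] :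
    ∑ x : F, x ^ (Fintype.card F - 1) = -1 := by
  classical
  have hq : 1 < Fintype.card F := Fintype.one_lt_card
  have h : ∀ x : F, x ^ (Fintype.card F - 1) = 1 - if x = 0 then 1 else 0 := by
    intro x
    split_ifs with hx
    · rw [hx, zero_pow (by omega), sub_self]
    · rw [FiniteField.pow_card_sub_one_eq_one x hx, sub_zero]
  simp [h, Finset.sum_sub_distrib]

theorem sum_eval_of_natDegree_le {F : Type*} [Field F] [Fintype F] {f : F[X]}
    (hf : f.natDegree ≤ Fintype.card F - 1) :
    ∑ x : F, f.eval x = -f.coeff (Fintype.card F - 1) := by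
  have hq : 1 < Fintype.card F := Fintype.one_lt_card
  simp_rw [eval_eq_sum_range' (Nat.lt_succ_of_le hf)]
  rw [Finset.sum_comm, Finset.sum_range_succ, Finset.sum_eq_zero, zero_add, ← Finset.mul_sum,
    sum_pow_card_sub_one, mul_neg_one]
  intro i hi
  rw [← Finset.mul_sum, FiniteField.sum_pow_lt_card_sub_one F i (Finset.mem_range.1 hi), mul_zero]

/-- Forms of complementary degrees `d + e = q - 1` give orthogonal words of length `q + 1`. -/
theorem sum_projEval_mul_projEval {F : Type*} [Field F] [Fintype F] {d e : ℕ} {f g : F[X]}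
    (hde : d + e = Fintype.card F - 1) (hf : f.natDegree ≤ d) (hg : g.natDegree ≤ e) :
    ∑ o : Option F, projEval d f o * projEval e g o = 0 := by
  simp_rw [← projEval_mul hf hg]
  rw [Fintype.sum_option]
  simp only [projEval, Option.elim]
  rw [sum_eval_of_natDegree_le (natDegree_mul_le.trans (by omega)), hde, add_neg_cancel]

/-- The dual of the code of forms of degree `d` has minimum distance at least `d + 2`: for at most
`d + 1` points there is a form of degree `d` that vanishes at all of them but a given one. -/
theorem card_support_of_forall_projEval {F : Type*} [Field F] [Fintype F] [DecidableEq F] (d : ℕ)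
    (b : Option F → F)
    (hb : b ≠ 0) (h : ∀ f : F[X], f.natDegree ≤ d → ∑ o, b o * projEval d f o = 0) :
    d + 2 ≤ (Finset.univ.filter fun o => b o ≠ 0).card := by
  classical
  by_contra! hcard
  obtain ⟨o₀, ho₀⟩ := Function.ne_iff.1 hb
  set T := (Finset.univ.filter fun o => b o ≠ 0).erase o₀ with hT
  have hTcard : T.card ≤ d := by
    rw [hT, Finset.card_erase_of_mem (by simpa using ho₀)]
    omega
  suffices hf : ∃ f : F[X], f.natDegree ≤ d ∧ (∀ o ∈ T, projEval d f o = 0) ∧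
      projEval d f o₀ ≠ 0 by
    obtain ⟨f, hfd, hfT, hf0⟩ := hf
    have := h f hfd
    rw [Finset.sum_eq_single o₀] at this
    · exact (mul_ne_zero ho₀ hf0) this
    · intro o _ ho
      by_cases hbo : b o = 0
      · rw [hbo, zero_mul]
      · rw [hfT o (by simp [hT, ho, hbo]), mul_zero]
    · simp
  have hfin : T.eraseNone.card = (T.erase none).card :=
    Finset.card_eraseNone_eq_card_erase T
  have hmonic : (∏ α ∈ T.eraseNone, (X - C α)).Monic :=
    monic_prod_of_monic _ _ fun α _ => monic_X_sub_C α
  have hdeg : (∏ α ∈ T.eraseNone, (X - C α)).natDegree = T.eraseNone.card := by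
    simp
  cases o₀ with
  | none =>
    -- at infinity the value is the top coefficient: a power of `X` pads the product to degree `d`
    have hnone : none ∉ T := by simp [hT]
    rw [Finset.erase_eq_of_notMem hnone] at hfin
    have hm := hmonic.mul (monic_X_pow (R := F) (d - T.card))
    have hd : ((∏ α ∈ T.eraseNone, (X - C α)) * X ^ (d - T.card)).natDegree = d := by
      rw [hmonic.natDegree_mul (monic_X_pow _), hdeg, natDegree_X_pow]
      omega
    refine ⟨(∏ α ∈ T.eraseNone, (X - C α)) * X ^ (d - T.card), hd.le, ?_, ?_⟩
    · rintro (_ | α) ho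
      · exact absurd ho hnone
      · have hα : α ∈ T.eraseNone := by simpa using ho
        simp only [projEval, Option.elim, eval_mul, eval_prod]
        rw [Finset.prod_eq_zero hα (by simp), zero_mul]
    · have := hm.coeff_natDegree
      rw [hd] at this
      simp [projEval, this]
  | some β =>
    have hle : T.eraseNone.card ≤ T.card := Finset.card_eraseNone_le T
    refine ⟨∏ α ∈ T.eraseNone, (X - C α), hdeg.trans_le (hle.trans hTcard), ?_, ?_⟩
    · rintro (_ | α) ho
      · rw [Finset.card_erase_of_mem ho] at hfin
        have := Finset.card_pos.2 ⟨_, ho⟩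
        exact coeff_eq_zero_of_natDegree_lt (hdeg.trans_lt (by omega))
      · have hα : α ∈ T.eraseNone := by simpa using ho
        simp only [projEval, Option.elim, eval_prod]
        exact Finset.prod_eq_zero hα (by simp)
    · simp only [projEval, Option.elim, eval_prod]
      refine Finset.prod_ne_zero_iff.2 fun α hα => ?_
      have : some α ∈ T := by simpa using hα
      have hne : some α ≠ some β := (Finset.mem_erase.1 this).1
      simpa [sub_eq_zero] using fun h => hne (congrArg some h.symm)

/-! ### Codes from nested evaluation codes -/

section

variable {F : Type*} [Field F]

theorem linearIndependent_projEval [Fintype F] {n : ℕ} {ι : Type*} [Fintype ι] (d : ℕ)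
    (e : Fin n ≃ Option F) {v : ι → F[X]} (hv : LinearIndependent F v)
    (hdeg : ∀ i, (v i).natDegree < Fintype.card F) :
    LinearIndependent F fun i j => projEval d (v i) (e j) := by
  rw [Fintype.linearIndependent_iff] at hv ⊢
  intro c hc
  refine hv c (eq_zero_of_projEval_eq_zero (d := d) ?_ ?_)
  · have hle : (∑ i, c i • v i).natDegree ≤ Fintype.card F - 1 :=
      natDegree_sum_le_of_forall_le _ _ fun i _ =>
        (natDegree_smul_le _ _).trans (Nat.le_sub_one_of_lt (hdeg i))
    have := Fintype.card_pos (α := F)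
    omega
  · rw [projEval_sum]
    funext o
    have := congrFun hc (e.symm o)
    simpa [projEval_smul] using this

theorem linearIndependent_X_pow (r : ℕ) :
    LinearIndependent F fun i : Fin r => (X ^ (i : ℕ) : F[X]) := by
  rw [Fintype.linearIndependent_iff]
  intro c hc i
  have := congrArg (fun f => f.coeff i) hc
  simpa [finsetSum_coeff, coeff_X_pow, Fin.val_inj] using this

theorem linearIndependent_one_cons_mul_X_pow {P : F[X]} (hP : 0 < P.natDegree) (r : ℕ) :
    LinearIndependent F
      (Fin.cons 1 fun i : Fin r => P * X ^ (i : ℕ) : Fin (r + 1) → F[X]) := by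
  have hP0 : P ≠ 0 := ne_zero_of_natDegree_gt hP
  refine linearIndependent_finCons.2 ⟨?_, fun h => ?_⟩
  · exact (linearIndependent_X_pow r).map' (LinearMap.mulLeft F P)
      (LinearMap.ker_eq_bot.2 (mul_right_injective₀ hP0))
  · have hle : Submodule.span F (Set.range fun i : Fin r => P * X ^ (i : ℕ)) ≤
        LinearMap.range (LinearMap.mulLeft F P) := by
      rw [Submodule.span_le]
      rintro _ ⟨i, rfl⟩
      exact ⟨X ^ (i : ℕ), rfl⟩
    obtain ⟨f, hf⟩ := hle h
    have := natDegree_eq_zero_of_isUnit (IsUnit.of_mul_eq_one f hf)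
    omega

/-- A word orthogonal to the values of the monomials, each scaled by the nowhere vanishing `v`, has
weight at least `d + 2`. -/
theorem le_card_support_of_sum_X_pow [Fintype F] [DecidableEq F] {n : ℕ} (d : ℕ)
    (e : Fin n ≃ Option F) {v : Option F → F} (hv : ∀ o, v o ≠ 0) {b : Fin n → F} (hb : b ≠ 0)
    (h : ∀ i : Fin (d + 1), ∑ j, b j * (v (e j) * projEval d (X ^ (i : ℕ)) (e j)) = 0) :
    d + 2 ≤ (Finset.univ.filter fun j => b j ≠ 0).card := by
  have key := card_support_of_forall_projEval d (fun o => b (e.symm o) * v o) ?_ ?_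
  · refine key.trans_eq ?_
    refine Finset.card_equiv e.symm fun o => ?_
    simp [hv o]
  · obtain ⟨j, hj⟩ := Function.ne_iff.1 hb
    refine Function.ne_iff.2 ⟨e j, ?_⟩
    simpa [hv] using hj
  · intro f hf
    have hf' : f = ∑ i : Fin (d + 1), f.coeff i • X ^ (i : ℕ) := by
      conv_lhs => rw [f.as_sum_range_C_mul_X_pow' (Nat.lt_succ_of_le hf)]
      rw [Finset.sum_range]
      simp only [smul_eq_C_mul]
    rw [← e.sum_comp, hf', projEval_sum]
    simp only [projEval_smul, Finset.sum_apply, Pi.smul_apply, smul_eq_mul, Finset.mul_sum,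
      Equiv.symm_apply_apply]
    rw [Finset.sum_comm]
    refine Finset.sum_eq_zero fun i _ => ?_
    have := congrArg (f.coeff i * ·) (h i)
    simp only [Finset.mul_sum, mul_zero] at this
    rw [← this]
    exact Finset.sum_congr rfl fun j _ => by ring

/-- The nested codes: with `Q` an irreducible quadratic form, the forms `Q ^ s f` of degree
`2 s + r` lie in the dual of the forms of degree `2 t`. -/
theorem exists_existsAQCC_of_add_eq_card [Fintype F] (p : ℕ) [Fact p.Prime]
    [Algebra (ZMod p) F] (hF : ringChar F ≠ 2) {n r s t g : ℕ} (hn : n = Fintype.card F + 1)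
    (hcard : 2 * s + r + 2 * t + 1 = Fintype.card F) (hs : 0 < s) (hg : 0 < g) :
    ∃ e₁ e₂, r + 2 ≤ e₁ ∧ 2 * t + 2 ≤ e₂ ∧ (∃ μ, ExistsAQCC p F n (2 * s) μ g e₁ e₂) ∧
      ∃ μ, ExistsAQCC p F n (2 * s) μ g e₂ e₁ := by
  classical
  obtain ⟨c, hc⟩ := FiniteField.exists_nonsquare hF
  set P : F[X] := (X ^ 2 - C c) ^ s with hP
  have hPmonic : P.Monic := (monic_X_pow_sub_C c two_ne_zero).pow s
  have hPdeg : P.natDegree = 2 * s := by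
    rw [hP, natDegree_pow, natDegree_X_pow_sub_C, mul_comm]
  have hPval : ∀ o, projEval (2 * s) P o ≠ 0 := by
    rintro (_ | α)
    · have := hPmonic.coeff_natDegree
      rw [hPdeg] at this
      simp [projEval, this]
    · simp only [projEval, Option.elim, hP, eval_pow, eval_sub, eval_X, eval_C]
      exact pow_ne_zero _ (sub_ne_zero.2 fun h => hc ⟨α, by rw [← h, sq]⟩)
  have hXdeg : ∀ {m : ℕ} (i : Fin (m + 1)), (X ^ (i : ℕ) : F[X]).natDegree ≤ m := fun i =>
    (natDegree_X_pow_le _).trans (Nat.lt_succ_iff.1 i.2)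
  have hPXdeg : ∀ i : Fin (r + 1), (P * X ^ (i : ℕ)).natDegree ≤ 2 * s + r := fun i =>
    natDegree_mul_le.trans (add_le_add hPdeg.le (hXdeg i))
  let e : Fin n ≃ Option F := (Fintype.equivFinOfCardEq (by simp [hn])).symm
  have hsum : ∀ f g : F[X], f.natDegree ≤ 2 * s + r → g.natDegree ≤ 2 * t →
      ∑ j, projEval (2 * s + r) f (e j) * projEval (2 * t) g (e j) = 0 := fun f g hf hg => by
    rw [e.sum_comp fun o => projEval (2 * s + r) f o * projEval (2 * t) g o]
    exact sum_projEval_mul_projEval (by omega) hf hg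
  refine exists_existsAQCC_of_delay p (r := r) (s := 2 * t + 1)
    (x := fun i j => projEval (2 * s + r) (P * X ^ (i : ℕ)) (e j))
    (y := fun j => projEval (2 * s + r) 1 (e j))
    (z := fun i j => projEval (2 * t) (X ^ (i : ℕ)) (e j)) (by omega) hg ?_ ?_ ?_ ?_ ?_ ?_
  · have := linearIndependent_projEval (2 * s + r) e
      (linearIndependent_one_cons_mul_X_pow (by omega : 0 < P.natDegree) (r + 1)) fun i => ?_
    · convert this using 1
      funext i
      refine Fin.cases ?_ (fun i => ?_) i <;> rfl
    · refine Fin.cases ?_ (fun i => ?_) i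
      · simpa using Fintype.card_pos (α := F)
      · have := hPXdeg i
        rw [Fin.cons_succ]
        omega
  · refine linearIndependent_projEval (2 * t) e (linearIndependent_X_pow _) fun i => ?_
    have := hXdeg i
    omega
  · exact fun i k => hsum _ _ (hPXdeg i) (hXdeg k)
  · exact fun k => hsum _ _ (by simp) (hXdeg k)
  · intro b hb h
    refine le_card_support_of_sum_X_pow r e hPval hb fun i => ?_
    simpa only [projEval_mul hPdeg.le (hXdeg i)] using h i
  · intro b hb h
    refine le_card_support_of_sum_X_pow (2 * t) e (v := 1) (fun _ => one_ne_zero) hb fun i => ?_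
    simpa using h i

/-- The codes in terms of the parameters `i` and `t`. If the flip distance exceeds the phase
distance, the two kinds of errors are exchanged; this keeps both bounds when `d ≤ n - 2 i`. -/
theorem exists_existsAQCC_ordered [Fintype F] (p : ℕ) [Fact p.Prime]
    [Algebra (ZMod p) F] (hodd : Odd (Fintype.card F)) {n i t g d : ℕ}
    (hn : n = Fintype.card F + 1) (hi : 2 * i + 2 ≤ n) (hti : t < i) (hg : 0 < g)
    (hd : d ≤ 2 * t + 2) :
    ∃ μ dz dx : ℕ, ExistsAQCC p F n (2 * i - 2 * t) μ g dz dx ∧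
      n - 2 * i ≤ dz ∧ d ≤ dx ∧ (d ≤ n - 2 * i → dx ≤ dz) := by
  have hF : ringChar F ≠ 2 := fun h => by
    have := FiniteField.even_card_iff_char_two.1 h
    rw [Nat.odd_iff] at hodd
    omega
  have hik : 2 * i - 2 * t = 2 * (i - t) := by omega
  obtain ⟨e₁, e₂, he₁, he₂, ⟨μ, h⟩, μ', h'⟩ := exists_existsAQCC_of_add_eq_card p hF
    (r := Fintype.card F - 2 * i - 1) (s := i - t) (t := t) (g := g) hn (by omega) (by omega) hg
  rw [hik]
  by_cases hle : e₂ ≤ e₁ ∨ n - 2 * i < d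
  · exact ⟨μ, e₁, e₂, h, by omega, by omega, by omega⟩
  · exact ⟨μ', e₂, e₁, h', by omega, by omega, by omega⟩

end

end QuantumConv

theorem theorem5 (p l q n a : ℕ) [Fact p.Prime] (hp : Odd p) (hl : 2 ≤ l)
    (hq : q = p ^ l) (hn : n = q + 1) (ha : a = n / 2)
    (F : Type*) [Field F] [Algebra (ZMod p) F] (hF : Nat.card F = q) :
    (∀ i t : ℕ, 3 ≤ i → i ≤ a - 1 → 1 ≤ t → t ≤ i - 2 →
      ∃ μ dz dx : ℕ, QuantumConv.ExistsAQCC p F n (2 * i - 2 * t - 2) μ 6 dz dx ∧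
        n - 2 * i ≤ dz ∧ 2 * t + 2 ≤ dx ∧ (2 * t + 2 ≤ n - 2 * i → dx ≤ dz)) ∧
    (∀ i t : ℕ, 2 ≤ i → i ≤ a - 1 → 1 ≤ t → t ≤ i - 1 →
      ∃ μ dz dx : ℕ, QuantumConv.ExistsAQCC p F n (2 * i - 2 * t) μ 4 dz dx ∧
        n - 2 * i ≤ dz ∧ 2 * t + 2 ≤ dx ∧ (2 * t + 2 ≤ n - 2 * i → dx ≤ dz)) := by
  have hodd : Odd q := hq ▸ hp.pow
  have hfin : Finite F := Nat.finite_of_card_ne_zero (by rw [hF]; exact hodd.pos.ne')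
  have := Fintype.ofFinite F
  rw [Nat.card_eq_fintype_card] at hF
  subst hF
  constructor
  · intro i t hi hia ht hti
    -- the loss of two in the dimension allows `t + 1` in place of `t`
    have h : 2 * i - 2 * t - 2 = 2 * i - 2 * (t + 1) := by omega
    rw [h]
    exact QuantumConv.exists_existsAQCC_ordered p hodd hn (by omega) (by omega) (by omega)
      (by omega)
  · intro i t hi hia ht hti
    exact QuantumConv.exists_existsAQCC_ordered p hodd hn (by omega) (by omega) (by omega)
      le_rfl
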